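/- Let $k,n\ge 0$ be integers. An ordered tree is a rooted tree in which the children of each vertex are linearly ordered. A \emph{$k$-colored ordered forest on $[n]=\{1,\dots,n\}$} is a linearly ordered sequence of ordered trees, with total vertex set $[n]$, whose edges are colored with colors $1,\dots,k$ so that among the children of any vertex those joined to it by an edge of color $1$ come first, then those of color $2$, and so on (not every color need appear). For such a forest $F$, a vertex is \emph{proper} if it is less than all of its proper descendants; let $\operatorname{prop}F$ be the number of proper vertices of $F$, and let $\operatorname{comp}F$ be the number of left-to-right minima in the sequence of roots of the trees of $F$ (roots that are less than all roots preceding them). Let $$P_n(a,b,c)=c\prod_{i=1}^{n-1}\bigl(ia+(n-i)b+c\bigr)\quad(n\ge1),\qquad P_0(a,b,c)=1.$$ Then $\operatorname{comp}F\le\operatorname{prop}F\le n$ for every $k$-colored ordered forest $F$ on $[n]$, and $$\sum_F u^{\,n-\operatorname{prop}F}\,v^{\,\operatorname{prop}F-\operatorname{comp}F}\,w^{\operatorname{comp}F}=P_n\bigl(ku,(k+1)v,w\bigr),$$ where the sum is over all $k$-colored ordered forests $F$ on $[n]$; the identity holds for all $u,v,w$ in any commutative ring, i.e. as an identity of polynomials.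 -/

import Mathlib

/-- Ordered rooted trees whose vertices carry labels in `α` and whose edges carry one of `k` colors.
`node a cs` is the tree whose root is labeled `a` and whose children, listed from first to last,
are the roots of the trees in `cs`; each comes with the color of the edge joining it to the root. -/
inductive ColoredTree (k : ℕ) (α : Type) : Type
  | node (label : α) (children : List (Fin k × ColoredTree k α)) : ColoredTree k α

namespace ColoredTree

variable {k : ℕ} {α : Type}

/-- The label of the root. -/
def root : ColoredTree k α → α
  | node a _ => a

mutual

/-- The labels of all vertices of a tree, with multiplicity. -/
def labels : ColoredTree k α → List α
  | node a cs => a :: childLabels cs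

/-- The labels of all vertices of the trees in a list of children. -/
def childLabels : List (Fin k × ColoredTree k α) → List α
  | [] => []
  | (_, t) :: cs => labels t ++ childLabels cs

end

mutual

/-- At every vertex, the colors of the edges to its children weakly increase from first to last:
the children of color `0` come first, then those of color `1`, and so on. -/
def ColorsOrdered : ColoredTree k α → Prop
  | node _ cs => (cs.map Prod.fst).Pairwise (· ≤ ·) ∧ ChildColorsOrdered cs

/-- `ColorsOrdered` for all the trees in a list of children. -/
def ChildColorsOrdered : List (Fin k × ColoredTree k α) → Prop
  | [] => True
  | (_, t) :: cs => ColorsOrdered t ∧ ChildColorsOrdered cs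

end

mutual

/-- The number of proper vertices of a tree: the vertices whose label is less than the labels of
all their proper descendants. -/
def prop [LinearOrder α] : ColoredTree k α → ℕ
  | node a cs => (if ∀ b ∈ childLabels cs, a < b then 1 else 0) + childProp cs

/-- The total number of proper vertices of the trees in a list of children. -/
def childProp [LinearOrder α] : List (Fin k × ColoredTree k α) → ℕ
  | [] => 0
  | (_, t) :: cs => prop t + childProp cs

end

/-- Only finitely many lists of children with labels in a finite set have at most `m` vertices. -/
theorem finite_childLabels_length_le [Finite α] (m : ℕ) :
    {cs : List (Fin k × ColoredTree k α) | (childLabels cs).length ≤ m}.Finite := by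
  induction m with
  | zero =>
    refine (Set.finite_singleton []).subset ?_
    rintro (_ | ⟨⟨c, ⟨a, ds⟩⟩, cs⟩) h
    · simp
    · simp [childLabels, labels] at h
  | succ m ih =>
    refine ((Set.finite_singleton []).union
      (((Set.finite_univ (α := Fin k × α)).prod (ih.prod ih)).image
        fun p => (p.1.1, node p.1.2 p.2.1) :: p.2.2)).subset ?_
    rintro (_ | ⟨⟨c, ⟨a, ds⟩⟩, cs⟩) h
    · simp
    · right
      simp only [Set.mem_ofPred_eq, childLabels, labels, List.length_append, List.length_cons] at h
      refine ⟨((c, a), (ds, cs)), ⟨Set.mem_univ _, ?_, ?_⟩, rfl⟩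
      · simp only [Set.mem_ofPred_eq]
        omega
      · simp only [Set.mem_ofPred_eq]
        omega

/-- Only finitely many lists of trees with labels in a finite set have at most `m` vertices. -/
theorem finite_labels_length_le [Finite α] (m : ℕ) :
    {ts : List (ColoredTree k α) | (ts.flatMap labels).length ≤ m}.Finite := by
  induction m with
  | zero =>
    refine (Set.finite_singleton []).subset ?_
    rintro (_ | ⟨⟨a, ds⟩, ts⟩) h
    · simp
    · simp [labels] at h
  | succ m ih =>
    refine ((Set.finite_singleton []).union
      (((Set.finite_univ (α := α)).prod ((finite_childLabels_length_le m).prod ih)).image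
        fun p => node p.1 p.2.1 :: p.2.2)).subset ?_
    rintro (_ | ⟨⟨a, ds⟩, ts⟩) h
    · simp
    · right
      simp only [Set.mem_ofPred_eq, labels, List.flatMap_cons, List.length_append,
        List.length_cons] at h
      refine ⟨(a, (ds, ts)), ⟨Set.mem_univ _, ?_, ?_⟩, rfl⟩
      · simp only [Set.mem_ofPred_eq]
        omega
      · simp only [Set.mem_ofPred_eq]
        omega

end ColoredTree

/-- A `k`-colored ordered forest on `[n]`: a sequence of ordered trees with `k`-colored edges, such
that among the children of any vertex the colors weakly increase, and such that every element of
the label set occurs as the label of exactly one vertex. The label set `[n]` is modeled by `Fin n`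
with its usual order. -/
@[ext]
structure ColoredForest (k n : ℕ) where
  /-- The trees of the forest, from first to last. -/
  trees : List (ColoredTree k (Fin n))
  colorsOrdered : ∀ t ∈ trees, t.ColorsOrdered
  labels_nodup : (trees.flatMap ColoredTree.labels).Nodup
  mem_labels : ∀ i : Fin n, i ∈ trees.flatMap ColoredTree.labels

/-- The number of left-to-right minima of a sequence, i.e. of the entries that are less than all
the entries before them (in particular the first entry is one). -/
def leftRightMinima {α : Type} [LinearOrder α] (l : List α) : ℕ :=
  (Finset.univ.filter fun i : Fin l.length => ∀ j : Fin l.length, j < i → l.get i < l.get j).card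

namespace ColoredForest

variable {k n : ℕ}

/-- The number of proper vertices of a forest. -/
def prop (F : ColoredForest k n) : ℕ := (F.trees.map ColoredTree.prop).sum

/-- The number of components of a forest: the left-to-right minima in the sequence of roots. -/
def comp (F : ColoredForest k n) : ℕ := leftRightMinima (F.trees.map ColoredTree.root)

/-- There are only finitely many `k`-colored ordered forests on `[n]`. -/
instance : Finite (ColoredForest k n) := by
  have hinj : Function.Injective (trees : ColoredForest k n → _) := fun F G h =>
    ColoredForest.ext h
  refine Set.finite_univ_iff.mp (Set.Finite.of_finite_image
    ((ColoredTree.finite_labels_length_le (k := k) (α := Fin n) n).subset ?_) hinj.injOn)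
  rintro _ ⟨F, -, rfl⟩
  simpa using F.labels_nodup.length_le_card

noncomputable instance : Fintype (ColoredForest k n) := Fintype.ofFinite _

end ColoredForest

/-- The polynomials `P_n(a, b, c) = c ∏_{i=1}^{n-1} (i a + (n - i) b + c)`, with `P_0 = 1`. -/
def forestPoly {R : Type*} [CommRing R] (n : ℕ) (a b c : R) : R :=
  if n = 0 then 1
  else c * ∏ i ∈ Finset.Icc 1 (n - 1), ((i : R) * a + ((n : R) - (i : R)) * b + c)

-- Put a = ku and b = (k+1)v. For a ≠ b in characteristic 0 the polynomials P_n(a, b, ·) are of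
-- binomial type (`forestPoly_add`), so multiplying exponential generating functions in n adds the
-- last arguments. Let T be the generating function of weighted trees and G_j that of child lists
-- with colors at least j. Splitting off a first child of color j gives G_j = G_{j+1} + T G_j with
-- G_k = 1, while choosing the root gives a factor v + mu times a child list on the m remaining
-- labels. These recursions are solved by P(iv) for G_{k-i} and 1 - P(-v) for T (`sum_childWeight`,
-- `sum_weight`). For forests, the left-to-right minima of r distinct keys, over all orderings, have
-- generating function x(x+1)⋯(x+r-1), whatever the keys are. Hence the roots may be replaced by the
-- least labels of the trees, and only the increasing ordering kept, with this factor
-- (`sum_mul_rightLeftProd_eq`). Removing the tree that contains the least label then gives a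
-- recursion solved by P_n(a, b, xv) (`sum_sortedWeight`). Setting x = w/v needs v ≠ 0 and a ≠ b;
-- both hold for indeterminates over ℤ, and the identity there specializes to every commutative
-- ring.

set_option linter.unusedSectionVars false

-- Difference equations and binomial convolutions for the polynomials P_n.

/-- The product `∏ (e + i a + (n - i) b)` over `1 ≤ i ≤ n`. -/
def forestProd {R : Type*} [CommRing R] (n : ℕ) (a b e : R) : R :=
  ∏ i ∈ Finset.range n, (e + n * b + (i + 1) * (a - b))

section
open Finset Polynomial
variable {K : Type*} [Field K]

theorem forestPoly_zero {R : Type*} [CommRing R] (a b c : R) : forestPoly 0 a b c = 1 := by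
  simp [forestPoly]

theorem forestPoly_succ {R : Type*} [CommRing R] (n : ℕ) (a b c : R) :
    forestPoly (n + 1) a b c = c * forestProd n a b (c + b) := by
  rw [forestPoly, if_neg n.succ_ne_zero, forestProd, Nat.add_sub_cancel,
    ← Finset.Ico_add_one_right_eq_Icc, Finset.prod_Ico_eq_prod_range, Nat.add_sub_cancel]
  congr 1
  refine prod_congr rfl fun i _ => ?_
  push_cast
  ring

theorem forestPoly_apply_zero {R : Type*} [CommRing R] (n : ℕ) (a b : R) :
    forestPoly n a b 0 = if n = 0 then 1 else 0 := by
  simp [forestPoly]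

theorem forestProd_add_sub (n : ℕ) (a b e : K) :
    forestProd (n + 1) a b (e + (a - b)) =
      forestProd (n + 1) a b e + (n + 1) * (a - b) * forestProd n a b (e + a) := by
  simp only [forestProd]
  rw [prod_range_succ, prod_range_succ' (fun i : ℕ => e + ((n + 1 : ℕ) : K) * b + (i + 1) * (a - b))]
  have h1 : ∀ i ∈ range n, e + (a - b) + ((n + 1 : ℕ) : K) * b + ((i : K) + 1) * (a - b) =
      e + a + n * b + (i + 1) * (a - b) := fun i _ => by push_cast; ring
  have h2 : ∀ i ∈ range n, e + ((n + 1 : ℕ) : K) * b + (((i + 1 : ℕ) : K) + 1) * (a - b) =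
      e + a + n * b + (i + 1) * (a - b) := fun i _ => by push_cast; ring
  rw [prod_congr rfl h1, prod_congr rfl h2]
  push_cast
  ring

/-- Shifting c by a - b turns each linear factor of the product into the next one, so the two values
on level n + 1 share all but their extreme factors; the shared ones are those of P_n at c + a. -/
theorem forestPoly_add_sub (n : ℕ) (a b c : K) :
    forestPoly (n + 1) a b (c + (a - b)) =
      forestPoly (n + 1) a b c + (n + 1) * (a - b) * forestPoly n a b (c + a) := by
  cases n with
  | zero => simp [forestPoly_succ, forestPoly_zero, forestProd]
  | succ n =>
    simp only [forestPoly_succ, forestProd]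
    rw [prod_range_succ,
      prod_range_succ' (fun i : ℕ => c + b + ((n + 1 : ℕ) : K) * b + (i + 1) * (a - b))]
    have h1 : ∀ i ∈ range n, c + (a - b) + b + ((n + 1 : ℕ) : K) * b + ((i : K) + 1) * (a - b) =
        c + a + b + n * b + (i + 1) * (a - b) := fun i _ => by push_cast; ring
    have h2 : ∀ i ∈ range n, c + b + ((n + 1 : ℕ) : K) * b + (((i + 1 : ℕ) : K) + 1) * (a - b) =
        c + a + b + n * b + (i + 1) * (a - b) := fun i _ => by push_cast; ring
    rw [prod_congr rfl h1, prod_congr rfl h2]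
    push_cast
    ring

theorem exists_eval_eq_forestProd (n : ℕ) (a b e : K) :
    ∃ p : K[X], ∀ c, forestProd n a b (e + c) = p.eval c :=
  ⟨∏ i ∈ range n, (C (e + n * b + (i + 1) * (a - b)) + X), fun c => by
    simp only [forestProd, eval_prod, eval_add, eval_C, eval_X]
    exact prod_congr rfl fun i _ => by ring⟩

theorem exists_eval_eq_forestPoly (n : ℕ) (a b e : K) :
    ∃ p : K[X], ∀ c, forestPoly n a b (e + c) = p.eval c := by
  cases n with
  | zero => exact ⟨1, by simp [forestPoly_zero]⟩
  | succ n =>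
    obtain ⟨p, hp⟩ := exists_eval_eq_forestProd n a b (e + b)
    refine ⟨(C e + X) * p, fun c => ?_⟩
    rw [forestPoly_succ, eval_mul, ← hp, eval_add, eval_C, eval_X]
    congr 2
    ring

variable [CharZero K] {a b : K}

/-- A sequence of polynomials satisfying the difference equation of `forestPoly` is determined by
its values at `0`. -/
theorem eq_sum_choose_mul_forestPoly (hab : a ≠ b)
    (f : ℕ → K → K) (hf : ∀ n, ∃ p : K[X], ∀ c, f n c = p.eval c)
    (h0 : ∀ c, f 0 c = f 0 0)
    (hd : ∀ n c, f (n + 1) (c + (a - b)) = f (n + 1) c + (n + 1) * (a - b) * f n (c + a))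
    (n : ℕ) (c : K) :
    f n c = ∑ i ∈ range (n + 1), (n.choose i : K) * (f i 0 * forestPoly (n - i) a b c) := by
  induction n generalizing c with
  | zero => simp [forestPoly, h0 c]
  | succ n ih =>
    set g : K → K := fun c => f (n + 1) c -
      ∑ i ∈ range (n + 2), ((n + 1).choose i : K) * (f i 0 * forestPoly (n + 1 - i) a b c) with hg
    suffices h : ∀ c, g c = 0 by
      have := h c
      simp only [hg] at this
      linear_combination this
    -- P_m vanishes at 0 for m > 0, so only the term i = n + 1 survives.
    have hg0 : g 0 = 0 := by
      simp only [hg]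
      rw [sum_range_succ, sum_eq_zero]
      · simp [forestPoly]
      · intro i hi
        have : n + 1 - i ≠ 0 := by have := mem_range.1 hi; omega
        simp [forestPoly, this]
    have hper : ∀ c, g (c + (a - b)) = g c := by
      intro c
      have key : ∑ i ∈ range (n + 2), ((n + 1).choose i : K) *
            (f i 0 * forestPoly (n + 1 - i) a b (c + (a - b))) =
          ∑ i ∈ range (n + 2), ((n + 1).choose i : K) *
            (f i 0 * forestPoly (n + 1 - i) a b c) + (n + 1) * (a - b) * f n (c + a) := by
        rw [ih, mul_sum, sum_range_succ _ (n + 1), sum_range_succ _ (n + 1), add_right_comm,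
          ← sum_add_distrib]
        simp only [Nat.sub_self]
        congr 1
        · refine sum_congr rfl fun i hi => ?_
          have hi' : i ≤ n := Nat.lt_succ_iff.1 (mem_range.1 hi)
          rw [Nat.succ_sub hi', Nat.succ_eq_add_one, forestPoly_add_sub]
          have hc : ((n + 1).choose i : K) * ((n - i : ℕ) + 1) = (n + 1) * n.choose i := by
            have := Nat.choose_mul_succ_eq n i
            rw [Nat.succ_sub hi'] at this
            have h2 : ((n.choose i * (n + 1) : ℕ) : K) = ((n + 1).choose i * (n - i).succ : ℕ) := by
              rw [this]
            push_cast at h2 ⊢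
            linear_combination -h2
          linear_combination (f i 0 * (a - b) * forestPoly (n - i) a b (c + a)) * hc
      simp only [hg, hd, key]
      ring
    have hmul : ∀ m : ℕ, g (m * (a - b)) = 0 := by
      intro m
      induction m with
      | zero => simpa using hg0
      | succ m ihm => rw [← ihm, ← hper (m * (a - b))]; congr 1; push_cast; ring
    choose p hp using hf
    choose q hq using fun n => exists_eval_eq_forestPoly n a b 0
    simp only [zero_add] at hq
    set r : K[X] := p (n + 1) - ∑ i ∈ range (n + 2), C ((n + 1).choose i * f i 0) * q (n + 1 - i)
    have hr : ∀ c, g c = r.eval c := by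
      intro c
      simp [hg, r, eval_finsetSum, hp, hq, mul_assoc]
    -- The difference is a polynomial with period a - b ≠ 0 and value 0 at 0, so it has infinitely
    -- many roots.
    have hr0 : r = 0 := by
      refine eq_zero_of_infinite_isRoot r (Set.Infinite.mono (s := Set.range
        fun m : ℕ => (m : K) * (a - b)) ?_ (Set.infinite_range_of_injective ?_))
      · rintro _ ⟨m, rfl⟩
        exact (hr _).symm.trans (hmul m)
      · intro m m' h
        exact_mod_cast mul_right_cancel₀ (sub_ne_zero.2 hab) h
    intro c
    rw [hr, hr0, eval_zero]

theorem forestPoly_add (hab : a ≠ b) (n : ℕ) (e c : K) :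
    forestPoly n a b (e + c) = ∑ i ∈ range (n + 1),
      (n.choose i : K) * (forestPoly i a b e * forestPoly (n - i) a b c) := by
  simpa using eq_sum_choose_mul_forestPoly hab (fun n c => forestPoly n a b (e + c))
    (fun n => exists_eval_eq_forestPoly n a b e) (by simp [forestPoly_zero])
    (fun n c => by simpa only [add_assoc] using forestPoly_add_sub n a b (e + c))
    n c

theorem forestProd_add (hab : a ≠ b) (n : ℕ) (e c : K) :
    forestProd n a b (e + c) = ∑ i ∈ range (n + 1),
      (n.choose i : K) * (forestProd i a b e * forestPoly (n - i) a b c) := by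
  simpa using eq_sum_choose_mul_forestPoly hab (fun n c => forestProd n a b (e + c))
    (fun n => exists_eval_eq_forestProd n a b e) (by simp [forestProd])
    (fun n c => by simpa only [add_assoc] using forestProd_add_sub n a b (e + c))
    n c

end

theorem Finset.val_add_val_sdiff {α : Type*} [DecidableEq α] {E S : Finset α} (h : E ⊆ S) :
    E.val + (S \ E).val = S.val := by
  rw [Finset.sdiff_val]
  exact add_tsub_cancel_of_le (Finset.val_le_iff.2 h)

theorem Finset.exists_eq_val_of_add_eq_val {α : Type*} [DecidableEq α] {S : Finset α}
    {A B : Multiset α} (h : A + B = S.val) : ∃ E ⊆ S, A = E.val ∧ B = (S \ E).val := by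
  have hA : A ≤ S.val := h ▸ Multiset.le_add_right A B
  refine ⟨⟨A, Multiset.nodup_of_le hA S.nodup⟩, Finset.val_le_iff.1 hA, rfl, ?_⟩
  rw [Finset.sdiff_val]
  exact (tsub_eq_of_eq_add_rev h.symm).symm

-- Weights of trees, and decompositions of trees and child lists.

namespace ColoredTree

section weight
variable {k : ℕ} {α : Type} [LinearOrder α] {R : Type*} [CommRing R] (u v : R)

mutual

/-- The weight of a tree: the product of `v` for each proper and `u` for each other vertex. -/
def weight : ColoredTree k α → R
  | node a cs => (if ∀ b ∈ childLabels cs, a < b then v else u) * childWeight cs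

/-- The product of the weights of the trees in a list of children. -/
def childWeight : List (Fin k × ColoredTree k α) → R
  | [] => 1
  | (_, t) :: cs => weight t * childWeight cs

end

mutual

theorem prop_le_length_labels : ∀ t : ColoredTree k α, t.prop ≤ t.labels.length
  | node a cs => by
    have := childProp_le_length_childLabels cs
    simp only [prop, labels, List.length_cons]
    split_ifs <;> omega

theorem childProp_le_length_childLabels : ∀ cs : List (Fin k × ColoredTree k α),
    childProp cs ≤ (childLabels cs).length
  | [] => by simp [childProp]
  | (_, t) :: cs => by
    have := prop_le_length_labels t
    have := childProp_le_length_childLabels cs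
    simp only [childProp, childLabels, List.length_append]
    omega

end

mutual

theorem weight_eq : ∀ t : ColoredTree k α,
    weight u v t = u ^ (t.labels.length - t.prop) * v ^ t.prop
  | node a cs => by
    have h := childProp_le_length_childLabels cs
    rw [weight, childWeight_eq cs, prop, labels, List.length_cons]
    split_ifs
    · rw [Nat.add_comm 1, Nat.add_sub_add_right, pow_succ v]
      ring
    · rw [Nat.zero_add, Nat.succ_sub h, pow_succ u]
      ring

theorem childWeight_eq : ∀ cs : List (Fin k × ColoredTree k α),
    childWeight u v cs = u ^ ((childLabels cs).length - childProp cs) * v ^ childProp cs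
  | [] => by simp [childWeight, childProp, childLabels]
  | (_, t) :: cs => by
    have h1 := prop_le_length_labels t
    have h2 := childProp_le_length_childLabels cs
    rw [childWeight, weight_eq t, childWeight_eq cs, childLabels, childProp, List.length_append,
      ← tsub_add_tsub_comm h1 h2, pow_add, pow_add]
    ring

end

theorem prod_map_weight (l : List (ColoredTree k α)) : (l.map (weight u v)).prod =
    u ^ ((l.flatMap labels).length - (l.map prop).sum) * v ^ (l.map prop).sum ∧
      (l.map prop).sum ≤ (l.flatMap labels).length := by
  induction l with
  | nil => simp
  | cons t l ih =>
    have h := prop_le_length_labels t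
    simp only [List.map_cons, List.prod_cons, List.sum_cons, List.flatMap_cons, List.length_append]
    refine ⟨?_, add_le_add h ih.2⟩
    rw [ih.1, weight_eq, ← tsub_add_tsub_comm h ih.2, pow_add, pow_add]
    ring

theorem one_le_prop : ∀ t : ColoredTree k α, 1 ≤ t.prop
  | node a cs => by
    rw [prop]
    match cs with
    | [] => simp [childLabels]
    | (_, t) :: cs =>
      have := one_le_prop t
      rw [childProp]
      omega

theorem length_le_sum_map_prop (l : List (ColoredTree k α)) : l.length ≤ (l.map prop).sum := by
  induction l with
  | nil => simp
  | cons t l ih =>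
    have := one_le_prop t
    simp only [List.map_cons, List.sum_cons, List.length_cons]
    omega

end weight

section finite
variable (k : ℕ) {α : Type} [LinearOrder α] [Fintype α]

theorem finite_childrenOn (j : ℕ) (S : Finset α) : {cs : List (Fin k × ColoredTree k α) |
    (cs.map Prod.fst).Pairwise (· ≤ ·) ∧ ChildColorsOrdered cs ∧ (∀ c ∈ cs, j ≤ (c.1 : ℕ)) ∧
      (childLabels cs : Multiset α) = S.val}.Finite := by
  refine (finite_childLabels_length_le S.card).subset fun cs h => ?_
  rw [Set.mem_ofPred_eq, ← Multiset.coe_card, h.2.2.2, Finset.card_val]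

theorem finite_forestsOn (S : Finset α) : {l : List (ColoredTree k α) |
    (∀ t ∈ l, t.ColorsOrdered) ∧ (l.flatMap labels : Multiset α) = S.val}.Finite := by
  refine (finite_labels_length_le S.card).subset fun l h => ?_
  rw [Set.mem_ofPred_eq, ← Multiset.coe_card, h.2, Finset.card_val]

theorem finite_treesOn (S : Finset α) : {t : ColoredTree k α |
    t.ColorsOrdered ∧ (t.labels : Multiset α) = S.val}.Finite := by
  refine Set.Finite.of_finite_image ((finite_forestsOn k S).subset ?_)
    (f := fun t => [t]) (List.singleton_injective.injOn)
  rintro _ ⟨t, h, rfl⟩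
  simpa using h

/-- The lists of children with label set `S` all of whose colors are at least `j`. -/
noncomputable def childrenOn (j : ℕ) (S : Finset α) : Finset (List (Fin k × ColoredTree k α)) :=
  (finite_childrenOn k j S).toFinset

/-- The sequences of trees with label set `S`. -/
noncomputable def forestsOn (S : Finset α) : Finset (List (ColoredTree k α)) :=
  (finite_forestsOn k S).toFinset

/-- The trees with label set `S`. -/
noncomputable def treesOn (S : Finset α) : Finset (ColoredTree k α) :=
  (finite_treesOn k S).toFinset

variable {k}

theorem mem_childrenOn {j : ℕ} {S : Finset α} {cs : List (Fin k × ColoredTree k α)} :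
    cs ∈ childrenOn k j S ↔ (cs.map Prod.fst).Pairwise (· ≤ ·) ∧ ChildColorsOrdered cs ∧
      (∀ c ∈ cs, j ≤ (c.1 : ℕ)) ∧ (childLabels cs : Multiset α) = S.val := by
  simp [childrenOn]

theorem mem_forestsOn {S : Finset α} {l : List (ColoredTree k α)} : l ∈ forestsOn k S ↔
    (∀ t ∈ l, t.ColorsOrdered) ∧ (l.flatMap labels : Multiset α) = S.val := by
  simp [forestsOn]

theorem mem_treesOn {S : Finset α} {t : ColoredTree k α} : t ∈ treesOn k S ↔
    t.ColorsOrdered ∧ (t.labels : Multiset α) = S.val := by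
  simp [treesOn]

theorem treesOn_empty : treesOn k (∅ : Finset α) = ∅ := by
  ext ⟨a, cs⟩
  simp [mem_treesOn, labels]

theorem childrenOn_self (S : Finset α) : childrenOn k k S = if S = ∅ then {[]} else ∅ := by
  ext cs
  rcases cs with _ | ⟨⟨c, t⟩, cs⟩
  · split_ifs with h
    · simp [mem_childrenOn, ChildColorsOrdered, childLabels, h]
    · simp [mem_childrenOn, ChildColorsOrdered, childLabels, eq_comm, h]
  · have : ¬ k ≤ (c : ℕ) := by omega
    split_ifs <;> simp [mem_childrenOn, this]

variable {R : Type*} [CommRing R] (u v : R)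

theorem cons_mem_childrenOn {j : Fin k} {S : Finset α} {t : ColoredTree k α}
    {cs : List (Fin k × ColoredTree k α)} : (j, t) :: cs ∈ childrenOn k j S ↔
      ∃ E ⊆ S, t ∈ treesOn k E ∧ cs ∈ childrenOn k j (S \ E) := by
  simp only [mem_childrenOn, mem_treesOn, List.map_cons, List.pairwise_cons, ChildColorsOrdered,
    childLabels, List.mem_cons, forall_eq_or_imp, le_refl, true_and, ← Multiset.coe_add]
  constructor
  · rintro ⟨⟨-, h1⟩, ⟨h2, h3⟩, h4, h5⟩
    obtain ⟨E, hE, hA, hB⟩ := Finset.exists_eq_val_of_add_eq_val h5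
    exact ⟨E, hE, ⟨h2, hA⟩, h1, h3, h4, hB⟩
  · rintro ⟨E, hE, ⟨h2, hA⟩, h1, h3, h4, hB⟩
    refine ⟨⟨fun c hc => ?_, h1⟩, ⟨h2, h3⟩, h4, ?_⟩
    · obtain ⟨p, hp, rfl⟩ := List.mem_map.1 hc
      exact h4 p hp
    · rw [hA, hB, Finset.val_add_val_sdiff hE]

/-- Colors weakly increase, so either color j is absent or the first child has color j; in the
second case the rest is again a list with colors at least j. -/
theorem sum_childWeight_childrenOn (j : Fin k) (S : Finset α) :
    ∑ cs ∈ childrenOn k j S, childWeight u v cs =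
      ∑ cs ∈ childrenOn k (j + 1) S, childWeight u v cs +
      ∑ E ∈ S.powerset, (∑ t ∈ treesOn k E, weight u v t) *
        ∑ cs ∈ childrenOn k j (S \ E), childWeight u v cs := by
  classical
  rw [← Finset.sum_filter_add_sum_filter_not (childrenOn k j S)
    (fun cs => ∀ c ∈ cs, (j : ℕ) + 1 ≤ (c.1 : ℕ))]
  congr 1
  · refine Finset.sum_congr ?_ fun _ _ => rfl
    ext cs
    simp only [Finset.mem_filter, mem_childrenOn]
    refine ⟨fun ⟨⟨h1, h2, _, h4⟩, h5⟩ => ⟨h1, h2, h5, h4⟩, fun ⟨h1, h2, h5, h4⟩ =>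
      ⟨⟨h1, h2, fun c hc => (h5 c hc).trans' (Nat.le_succ _), h4⟩, h5⟩⟩
  · simp only [Finset.sum_mul_sum, ← Finset.sum_product']
    rw [Finset.sum_sigma']
    symm
    refine Finset.sum_bij (fun x _ => (j, x.2.1) :: x.2.2) ?_ ?_ ?_ ?_
    · rintro ⟨E, t, cs⟩ h
      simp only [Finset.mem_sigma, Finset.mem_powerset, Finset.mem_product] at h
      rw [Finset.mem_filter, cons_mem_childrenOn]
      exact ⟨⟨E, h⟩, fun h' => by simpa using h' _ List.mem_cons_self⟩
    · rintro ⟨E, t, cs⟩ h ⟨E', t', cs'⟩ h' heq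
      simp only [Finset.mem_sigma, Finset.mem_powerset, Finset.mem_product, mem_treesOn] at h h'
      simp only [List.cons.injEq, Prod.mk.injEq, true_and] at heq
      obtain ⟨rfl, rfl⟩ := heq
      obtain rfl : E = E' := Finset.val_injective (h.2.1.2.symm.trans h'.2.1.2)
      rfl
    · intro cs hcs
      rw [Finset.mem_filter] at hcs
      rcases cs with _ | ⟨⟨c, t⟩, cs⟩
      · simp at hcs
      · obtain ⟨hcs, hc⟩ := hcs
        obtain rfl : c = j := by
          by_contra hne
          obtain ⟨h1, -, h2, -⟩ := mem_childrenOn.1 hcs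
          rw [List.map_cons, List.pairwise_cons] at h1
          have hlt : (j : ℕ) < c := lt_of_le_of_ne (h2 _ List.mem_cons_self)
            fun h => hne (Fin.ext h.symm)
          refine hc fun p hp => ?_
          rcases List.mem_cons.1 hp with rfl | hp
          · exact hlt
          · exact hlt.trans_le (h1.1 _ (List.mem_map_of_mem hp))
        obtain ⟨E, h⟩ := cons_mem_childrenOn.1 hcs
        exact ⟨⟨E, t, cs⟩, by simpa using h, rfl⟩
    · rintro ⟨E, t, cs⟩ _
      simp [childWeight]

/-- Remove the root a; whether it is proper depends only on a and S, not on the shape of the tree.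
-/
theorem sum_weight_treesOn (S : Finset α) : ∑ t ∈ treesOn k S, weight u v t =
    ∑ a ∈ S, (if ∀ b ∈ S.erase a, a < b then v else u) *
      ∑ cs ∈ childrenOn k 0 (S.erase a), childWeight u v cs := by
  simp only [Finset.mul_sum]
  rw [Finset.sum_sigma']
  symm
  have key : ∀ (a : α) (cs : List (Fin k × ColoredTree k α)), node a cs ∈ treesOn k S ↔
      a ∈ S ∧ cs ∈ childrenOn k 0 (S.erase a) := by
    intro a cs
    simp only [mem_treesOn, mem_childrenOn, ColorsOrdered, labels, Nat.zero_le, implies_true,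
      true_and, ← Multiset.cons_coe, Finset.erase_val, and_assoc]
    constructor
    · rintro ⟨h1, h2, h3⟩
      refine ⟨Finset.mem_def.2 (h3 ▸ Multiset.mem_cons_self _ _), h1, h2, ?_⟩
      rw [← h3, Multiset.erase_cons_head]
    · rintro ⟨h0, h1, h2, h3⟩
      exact ⟨h1, h2, by rw [h3, Multiset.cons_erase (Finset.mem_def.1 h0)]⟩
  refine Finset.sum_bij (fun x _ => node x.1 x.2) ?_ ?_ ?_ ?_
  · rintro ⟨a, cs⟩ h
    exact (key a cs).2 (Finset.mem_sigma.1 h)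
  · rintro ⟨a, cs⟩ _ ⟨a', cs'⟩ _ h
    simpa using h
  · rintro ⟨a, cs⟩ h
    exact ⟨⟨a, cs⟩, Finset.mem_sigma.2 ((key a cs).1 h), rfl⟩
  · rintro ⟨a, cs⟩ h
    have h2 := (mem_childrenOn.1 (Finset.mem_sigma.1 h).2).2.2.2
    have h3 : ∀ b, b ∈ childLabels cs ↔ b ∈ S.erase a := fun b => by
      rw [← Multiset.mem_coe, h2, Finset.mem_val]
    simp only [weight, h3]

end finite

end ColoredTree

-- Minima statistics summed over all orderings of a set.

section

/-- Only the element with the least key receives x. -/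
theorem sum_ite_forall_erase_lt {τ α R : Type*} [DecidableEq τ] [LinearOrder α] [CommRing R]
    (key : τ → α) (x y : R) (s : Finset τ) (hs : s.Nonempty) (hkey : Set.InjOn key s) :
    ∑ t ∈ s, (if ∀ t' ∈ s.erase t, key t < key t' then x else y) = x + (s.card - 1 : ℕ) * y := by
  obtain ⟨m, hm, hmin⟩ := s.exists_min_image key hs
  rw [← Finset.add_sum_erase s _ hm, if_pos, Finset.sum_congr rfl (g := fun _ => y)]
  · simp [Finset.card_erase_of_mem hm]
  · intro t ht
    obtain ⟨hne, ht⟩ := Finset.mem_erase.1 ht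
    exact if_neg fun h => (h m (Finset.mem_erase.2 ⟨hne.symm, hm⟩)).not_ge (hmin t ht)
  · intro t ht
    obtain ⟨hne, ht⟩ := Finset.mem_erase.1 ht
    exact lt_of_le_of_ne (hmin t ht) fun h => hne (hkey ht hm h.symm)

/-- The product over the entries of a list of `x` for each entry whose key is less than the keys of
all later entries, and `y` for each other entry. -/
def rightLeftProd {τ α R : Type*} [LinearOrder α] [CommRing R] (key : τ → α) (x y : R) :
    List τ → R
  | [] => 1
  | t :: l => (if ∀ t' ∈ l, key t < key t' then x else y) * rightLeftProd key x y l

variable {τ α R : Type*} [LinearOrder α] [CommRing R]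

theorem sum_lists_cons [DecidableEq τ] {M : Type*} [AddCommMonoid M] (s : Finset τ)
    (hs : s.Nonempty) (f : List τ → M) :
    ∑ l ∈ s.val.lists.toFinset, f l = ∑ t ∈ s, ∑ l ∈ (s.erase t).val.lists.toFinset, f (t :: l) := by
  rw [Finset.sum_sigma']
  symm
  have key : ∀ t l, t :: l ∈ s.val.lists.toFinset ↔ t ∈ s ∧ l ∈ (s.erase t).val.lists.toFinset := by
    intro t l
    simp only [Multiset.mem_toFinset, Multiset.mem_lists_iff, Multiset.quot_mk_to_coe, ← Multiset.cons_coe,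
      Finset.erase_val]
    constructor
    · intro h
      exact ⟨Finset.mem_def.2 (h ▸ Multiset.mem_cons_self _ _), by rw [h, Multiset.erase_cons_head]⟩
    · rintro ⟨h0, h⟩
      rw [← h, Multiset.cons_erase (Finset.mem_def.1 h0)]
  refine Finset.sum_bij (fun x _ => x.1 :: x.2) ?_ ?_ ?_ ?_
  · rintro ⟨t, l⟩ h
    exact (key t l).2 (Finset.mem_sigma.1 h)
  · rintro ⟨t, l⟩ _ ⟨t', l'⟩ _ h
    simpa using h
  · rintro (_ | ⟨t, l⟩) h
    · simp [Multiset.mem_toFinset, Multiset.mem_lists_iff, hs.ne_empty] at h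
    · exact ⟨⟨t, l⟩, Finset.mem_sigma.2 ((key t l).1 h), rfl⟩
  · simp

/-- The choice of the first entry among i + 1 elements contributes x + iy, and the rest is
independent of it. With x = 1 and y = 0 this says that exactly one ordering is increasing. -/
theorem sum_lists_rightLeftProd [DecidableEq τ] (key : τ → α) (x y : R) (s : Finset τ)
    (hkey : Set.InjOn key s) : ∑ l ∈ s.val.lists.toFinset, rightLeftProd key x y l =
      ∏ i ∈ Finset.range s.card, (x + i * y) := by
  induction s using Finset.strongInduction with
  | H s ih =>
    rcases s.eq_empty_or_nonempty with rfl | hs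
    · have : (∅ : Finset τ).val.lists.toFinset = {[]} := by
        ext l
        simp [Multiset.mem_toFinset, Multiset.mem_lists_iff, eq_comm]
      rw [this]
      simp [rightLeftProd]
    · obtain ⟨n, hn⟩ : ∃ n, s.card = n + 1 := Nat.exists_eq_succ_of_ne_zero hs.card_pos.ne'
      rw [sum_lists_cons s hs, hn, Finset.prod_range_succ, mul_comm]
      have h1 := sum_ite_forall_erase_lt key x y s hs hkey
      rw [hn, Nat.add_sub_cancel] at h1
      rw [← h1, Finset.sum_mul]
      refine Finset.sum_congr rfl fun t ht => ?_
      have h2 := ih _ (Finset.erase_ssubset ht) (hkey.mono (Finset.erase_subset _ _))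
      rw [Finset.card_erase_of_mem ht, hn, Nat.add_sub_cancel] at h2
      rw [← h2, Finset.mul_sum]
      refine Finset.sum_congr rfl fun l hl => ?_
      have h3 : ∀ t', t' ∈ l ↔ t' ∈ s.erase t := fun t' => by
        rw [Finset.mem_def, (Multiset.mem_lists_iff (s.erase t).val l).1 (Multiset.mem_toFinset.1 hl)]
        rfl
      simp only [rightLeftProd, h3]

/-- In a sum over a permutation-closed set of lists, the generating function of right-to-left
minima can be replaced by rising factorials, supported on the lists with increasing keys, for
another key. -/
theorem sum_mul_rightLeftProd_eq {β : Type*} [LinearOrder β] (X : Finset (List τ)) (W : List τ → R)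
    (key : τ → α) (key' : τ → β) (x : R)
    (hX : ∀ l ∈ X, ∀ l', l'.Perm l → l' ∈ X) (hW : ∀ l l', l'.Perm l → W l' = W l)
    (hnd : ∀ l ∈ X, l.Nodup) (hkey : ∀ l ∈ X, Set.InjOn key {t | t ∈ l})
    (hkey' : ∀ l ∈ X, Set.InjOn key' {t | t ∈ l}) :
    ∑ l ∈ X, W l * rightLeftProd key x 1 l =
      ∑ l ∈ X, W l * (rightLeftProd key' 1 0 l * ∏ i ∈ Finset.range l.length, (x + i)) := by
  classical
  have hmaps : ∀ l ∈ X, (l : Multiset τ) ∈ X.image (fun l : List τ => (l : Multiset τ)) :=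
    fun l hl => Finset.mem_image_of_mem (fun l : List τ => (l : Multiset τ)) hl
  -- On the orderings of one multiset `W` and the length are constant, so only the two minima sums
  -- need to be compared.
  rw [← Finset.sum_fiberwise_of_maps_to hmaps, ← Finset.sum_fiberwise_of_maps_to hmaps]
  refine Finset.sum_congr rfl fun m hm => ?_
  obtain ⟨l₀, hl₀, rfl⟩ := Finset.mem_image.1 hm
  set s : Finset τ := ⟨l₀, Multiset.coe_nodup.2 (hnd l₀ hl₀)⟩ with hs
  have hfib : X.filter (fun l : List τ => (l : Multiset τ) = l₀) = s.val.lists.toFinset := by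
    ext l
    simp only [Finset.mem_filter, Multiset.mem_toFinset, Multiset.mem_lists_iff, s]
    exact ⟨fun h => h.2.symm, fun h => ⟨hX l₀ hl₀ l (Multiset.coe_eq_coe.1 h.symm), h.symm⟩⟩
  have hmem : (s : Set τ) = {t | t ∈ l₀} := by
    ext t
    simp [s]
  have hperm : ∀ l ∈ s.val.lists.toFinset, l.Perm l₀ := fun l hl =>
    Multiset.coe_eq_coe.1 ((Multiset.mem_lists_iff _ _).1 (Multiset.mem_toFinset.1 hl)).symm
  rw [hfib, Finset.sum_congr rfl (g := fun l => W l₀ * rightLeftProd key x 1 l)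
    fun l hl => by rw [hW l₀ l (hperm l hl)],
    Finset.sum_congr rfl (s₁ := s.val.lists.toFinset) (f := fun l => W l * _)
    (g := fun l => W l₀ * ((∏ i ∈ Finset.range l₀.length, (x + i)) * rightLeftProd key' 1 0 l))
    fun l hl => by rw [hW l₀ l (hperm l hl), (hperm l hl).length_eq, mul_comm (rightLeftProd _ _ _ _)],
    ← Finset.mul_sum, ← Finset.mul_sum, ← Finset.mul_sum,
    sum_lists_rightLeftProd _ _ _ _ (hmem ▸ hkey l₀ hl₀),
    sum_lists_rightLeftProd _ _ _ _ (hmem ▸ hkey' l₀ hl₀)]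
  simp [s]

end

-- Left-to-right minima computed recursively.

section
variable {α : Type} [LinearOrder α]

theorem leftRightMinima_eq_sum {n : ℕ} (l : List α) (hn : l.length = n) :
    leftRightMinima l = ∑ i : Fin n,
      if ∀ j : Fin n, j < i → l[i] < l[j] then 1 else 0 := by
  subst hn
  rw [leftRightMinima, Finset.card_filter]
  rfl

theorem leftRightMinima_append_singleton (l : List α) (a : α) :
    leftRightMinima (l ++ [a]) = leftRightMinima l + if ∀ b ∈ l, a < b then 1 else 0 := by
  rw [leftRightMinima_eq_sum (n := l.length + 1) _ (by simp), Fin.sum_univ_castSucc,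
    leftRightMinima_eq_sum l rfl]
  congr 1
  · refine Finset.sum_congr rfl fun i _ => if_congr ?_ rfl rfl
    rw [Fin.forall_fin_succ']
    simp [Fin.le_last]
  · refine if_congr ?_ rfl rfl
    rw [Fin.forall_fin_succ']
    simp [List.forall_mem_iff_forall_getElem, Fin.forall_iff]

theorem leftRightMinima_le_length (l : List α) : leftRightMinima l ≤ l.length :=
  (Finset.card_filter_le _ _).trans_eq (Finset.card_fin _)

theorem pow_leftRightMinima {τ R : Type*} [CommRing R] (key : τ → α) (x : R) (l : List τ) :
    x ^ leftRightMinima (l.map key) = rightLeftProd key x 1 l.reverse := by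
  induction l using List.reverseRecOn with
  | nil => simp [leftRightMinima_eq_sum (n := 0), rightLeftProd]
  | append_singleton l t ih =>
    rw [List.map_append, List.map_singleton, leftRightMinima_append_singleton, pow_add, ih,
      List.reverse_append, List.reverse_singleton, List.singleton_append, rightLeftProd, mul_comm]
    congr 1
    simp only [List.mem_map, forall_exists_index, and_imp, forall_apply_eq_imp_iff₂,
      List.mem_reverse]
    split_ifs <;> simp

end

-- Total weight of trees and of child lists.

namespace ColoredTree

section

variable {k : ℕ} {α : Type} [LinearOrder α] [Fintype α]
variable {K : Type*} [Field K] [CharZero K] {u v : K}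

/-- For m > 0 the last factor on the left is kv + m(ku) = k(v + mu); its k joins v to form the
leading factor kv of P_m. -/
theorem forestProd_mul (m : ℕ) : v * forestProd m (k * u) ((k + 1) * v) (k * v) =
    (v + m * u) * forestPoly m (k * u) ((k + 1) * v) (k * v) := by
  cases m with
  | zero => simp [forestProd, forestPoly_zero]
  | succ m =>
    rw [forestPoly_succ, forestProd, forestProd, Finset.prod_range_succ]
    have h : ∀ i ∈ Finset.range m, (k : K) * v + (m + 1 : ℕ) * ((k + 1) * v) +
        (i + 1) * (k * u - (k + 1) * v) = k * v + (k + 1) * v + m * ((k + 1) * v) +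
        (i + 1) * (k * u - (k + 1) * v) := fun i _ => by push_cast; ring
    rw [Finset.prod_congr rfl h]
    push_cast
    ring

variable (k u v) in
/-- The total weight of the trees with `n` labels. -/
def treeWeight (n : ℕ) : K :=
  if n = 0 then 0 else v * forestProd (n - 1) (k * u) ((k + 1) * v) (k * v)

theorem treeWeight_eq (n : ℕ) : treeWeight k u v n =
    (if n = 0 then 1 else 0) - forestPoly n (k * u) ((k + 1) * v) (-v) := by
  cases n with
  | zero => simp [treeWeight, forestPoly_zero]
  | succ n =>
    rw [treeWeight, if_neg n.succ_ne_zero, if_neg n.succ_ne_zero, forestPoly_succ,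
      Nat.add_sub_cancel, show -v + ((k : K) + 1) * v = k * v by ring]
    ring

/-- In generating functions: T = 1 - P(-v), and multiplication by P(-v) shifts c to c - v. -/
theorem sum_treeWeight_mul (hk : (k : K) * u ≠ (k + 1) * v) (n : ℕ) (c : K) :
    ∑ i ∈ Finset.range (n + 1), (n.choose i : K) *
        (treeWeight k u v i * forestPoly (n - i) (k * u) ((k + 1) * v) c) =
      forestPoly n (k * u) ((k + 1) * v) c - forestPoly n (k * u) ((k + 1) * v) (-v + c) := by
  rw [forestPoly_add hk]
  simp only [treeWeight_eq, sub_mul, mul_sub, Finset.sum_sub_distrib]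
  congr 1
  rw [Finset.sum_range_succ']
  simp

/-- The hypothesis concerns proper subsets only, so that this can be used inside the induction on
label sets for child lists. -/
theorem sum_weight_treesOn_of_childrenOn (E : Finset α)
    (h : ∀ S ⊂ E, ∑ cs ∈ childrenOn k 0 S, childWeight u v cs =
      forestPoly S.card (k * u) ((k + 1) * v) (k * v)) :
    ∑ t ∈ treesOn k E, weight u v t = treeWeight k u v E.card := by
  rcases E.eq_empty_or_nonempty with rfl | hE
  · simp [treesOn_empty, treeWeight]
  · rw [sum_weight_treesOn, treeWeight, if_neg hE.card_pos.ne', forestProd_mul,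
      ← sum_ite_forall_erase_lt id v u E hE Function.injective_id.injOn,
      Finset.sum_mul]
    refine Finset.sum_congr rfl fun a ha => ?_
    rw [h _ (Finset.erase_ssubset ha), Finset.card_erase_of_mem ha]
    simp only [id_eq]
    congr

theorem sum_childWeight (hk : (k : K) * u ≠ (k + 1) * v) (S : Finset α) (i : ℕ) (hi : i ≤ k) :
    ∑ cs ∈ childrenOn k (k - i) S, childWeight u v cs =
      forestPoly S.card (k * u) ((k + 1) * v) (i * v) := by
  induction S using Finset.strongInduction generalizing i with
  | H S ihS =>
  induction i with
  | zero =>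
    rw [Nat.sub_zero, childrenOn_self]
    split_ifs with h <;> simp [h, childWeight, forestPoly_apply_zero]
  | succ i ihi =>
    have hj := sum_childWeight_childrenOn u v (⟨k - (i + 1), by omega⟩ : Fin k) S
    simp only [show k - (i + 1) + 1 = k - i by omega] at hj
    rw [hj, ihi (by omega)]
    have hterm : ∀ E ∈ S.powerset, (∑ t ∈ treesOn k E, weight u v t) *
        ∑ cs ∈ childrenOn k (k - (i + 1)) (S \ E), childWeight u v cs =
        treeWeight k u v E.card *
          forestPoly (S.card - E.card) (k * u) ((k + 1) * v) ((i + 1 : ℕ) * v) := by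
      intro E hE
      rw [Finset.mem_powerset] at hE
      rw [sum_weight_treesOn_of_childrenOn E fun E' hE' => by
        simpa using ihS E' (hE'.trans_subset hE) k le_rfl]
      -- There is no empty tree, so the term in which `S \ E` is all of `S` drops out and the
      -- induction hypothesis covers the others.
      rcases E.eq_empty_or_nonempty with rfl | hne
      · simp [treeWeight]
      · rw [ihS (S \ E) (Finset.sdiff_ssubset hE hne) (i + 1) hi, Finset.card_sdiff_of_subset hE]
    rw [Finset.sum_congr rfl hterm, Finset.sum_powerset_apply_card (fun m => treeWeight k u v m *
      forestPoly (S.card - m) (k * u) ((k + 1) * v) ((i + 1 : ℕ) * v))]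
    simp only [nsmul_eq_mul]
    rw [sum_treeWeight_mul hk, show -v + ((i + 1 : ℕ) : K) * v = i * v by push_cast; ring]
    ring

theorem sum_weight (hk : (k : K) * u ≠ (k + 1) * v) (E : Finset α) :
    ∑ t ∈ treesOn k E, weight u v t = treeWeight k u v E.card :=
  sum_weight_treesOn_of_childrenOn E fun S _ => by simpa using sum_childWeight hk S k le_rfl

end

-- Forests, sorted by the least labels of their trees.

section
variable {k : ℕ} {α : Type} [LinearOrder α]

theorem root_mem_labels (t : ColoredTree k α) : t.root ∈ t.labels := by
  cases t
  simp [root, labels]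

/-- The least label of a tree. -/
def minLabel (t : ColoredTree k α) : α :=
  t.labels.toFinset.min' ⟨t.root, List.mem_toFinset.2 t.root_mem_labels⟩

theorem minLabel_mem (t : ColoredTree k α) : t.minLabel ∈ t.labels :=
  List.mem_toFinset.1 (Finset.min'_mem _ _)

theorem minLabel_le {t : ColoredTree k α} {a : α} (h : a ∈ t.labels) : t.minLabel ≤ a :=
  Finset.min'_le _ _ (List.mem_toFinset.2 h)

theorem injOn_of_nodup_flatMap_labels {l : List (ColoredTree k α)}
    (h : (l.flatMap labels).Nodup) (key : ColoredTree k α → α) (hkey : ∀ t, key t ∈ t.labels) :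
    Set.InjOn key {t | t ∈ l} := by
  intro t ht t' ht' heq
  by_contra hne
  have : Std.Symm (Function.onFun List.Disjoint (labels (k := k) (α := α))) :=
    ⟨fun _ _ h => h.symm⟩
  exact (List.nodup_flatMap.1 h).2.forall ht ht' hne (hkey t) (heq ▸ hkey t')

theorem nodup_of_nodup_flatMap_labels {l : List (ColoredTree k α)}
    (h : (l.flatMap labels).Nodup) : l.Nodup :=
  (List.nodup_flatMap.1 h).2.imp fun {t t'} hd (heq : t = t') =>
    hd t.root_mem_labels (heq ▸ t.root_mem_labels)

variable [Fintype α]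

theorem nodup_of_mem_forestsOn {S : Finset α} {l : List (ColoredTree k α)}
    (h : l ∈ forestsOn k S) : (l.flatMap labels).Nodup := by
  rw [← Multiset.coe_nodup, (mem_forestsOn.1 h).2]
  exact S.nodup

theorem mem_forestsOn_of_perm {S : Finset α} {l l' : List (ColoredTree k α)}
    (h : l ∈ forestsOn k S) (hl : l'.Perm l) : l' ∈ forestsOn k S := by
  rw [mem_forestsOn] at h ⊢
  refine ⟨fun t ht => h.1 t (hl.mem_iff.1 ht), ?_⟩
  rw [← h.2, Multiset.coe_eq_coe]
  exact hl.flatMap_right _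

theorem cons_mem_forestsOn {S : Finset α} {t : ColoredTree k α} {l : List (ColoredTree k α)} :
    t :: l ∈ forestsOn k S ↔ ∃ E ⊆ S, t ∈ treesOn k E ∧ l ∈ forestsOn k (S \ E) := by
  simp only [mem_forestsOn, mem_treesOn, List.mem_cons, forall_eq_or_imp, List.flatMap_cons,
    ← Multiset.coe_add]
  constructor
  · rintro ⟨⟨h1, h2⟩, h3⟩
    obtain ⟨E, hE, hA, hB⟩ := Finset.exists_eq_val_of_add_eq_val h3
    exact ⟨E, hE, ⟨h1, hA⟩, h2, hB⟩
  · rintro ⟨E, hE, ⟨h1, hA⟩, h2, hB⟩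
    exact ⟨⟨h1, h2⟩, by rw [hA, hB, Finset.val_add_val_sdiff hE]⟩

theorem forestsOn_empty : forestsOn k (∅ : Finset α) = {[]} := by
  ext l
  rcases l with _ | ⟨⟨a, cs⟩, l⟩ <;> simp [mem_forestsOn, labels]

theorem sum_forestsOn {M : Type*} [AddCommMonoid M] {S : Finset α} (hS : S.Nonempty)
    (f : List (ColoredTree k α) → M) : ∑ l ∈ forestsOn k S, f l =
      ∑ E ∈ S.powerset, ∑ x ∈ treesOn k E ×ˢ forestsOn k (S \ E), f (x.1 :: x.2) := by
  rw [Finset.sum_sigma']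
  symm
  refine Finset.sum_bij (fun x _ => x.2.1 :: x.2.2) ?_ ?_ ?_ ?_
  · rintro ⟨E, t, l⟩ h
    simp only [Finset.mem_sigma, Finset.mem_powerset, Finset.mem_product] at h
    exact cons_mem_forestsOn.2 ⟨E, h⟩
  · rintro ⟨E, t, l⟩ h ⟨E', t', l'⟩ h' heq
    simp only [Finset.mem_sigma, Finset.mem_powerset, Finset.mem_product, mem_treesOn] at h h'
    simp only [List.cons.injEq] at heq
    obtain ⟨rfl, rfl⟩ := heq
    obtain rfl : E = E' := Finset.val_injective (h.2.1.2.symm.trans h'.2.1.2)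
    rfl
  · rintro (_ | ⟨t, l⟩) h
    · simp [mem_forestsOn, eq_comm, hS.ne_empty] at h
    · obtain ⟨E, h⟩ := cons_mem_forestsOn.1 h
      exact ⟨⟨E, t, l⟩, by simpa using h, rfl⟩
  · simp

/-- This is the gain of least labels over roots as keys: the condition depends only on the label set
`E` of the first tree. -/
theorem forall_minLabel_lt_iff {S E : Finset α} (hS : S.Nonempty) {t : ColoredTree k α}
    {l : List (ColoredTree k α)} (ht : t ∈ treesOn k E) (hl : l ∈ forestsOn k (S \ E))
    (hE : E ⊆ S) : (∀ t' ∈ l, t.minLabel < t'.minLabel) ↔ S.min' hS ∈ E := by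
  have ht' : ∀ a, a ∈ t.labels ↔ a ∈ E := fun a => by
    rw [← Multiset.mem_coe, (mem_treesOn.1 ht).2, Finset.mem_def]
  have hl' : ∀ a, (∃ t' ∈ l, a ∈ t'.labels) ↔ a ∈ S \ E := fun a => by
    rw [← List.mem_flatMap, ← Multiset.mem_coe, (mem_forestsOn.1 hl).2, Finset.mem_def]
  constructor
  · intro h
    by_contra hm
    obtain ⟨t', ht'l, hmt⟩ := (hl' _).2 (Finset.mem_sdiff.2 ⟨S.min'_mem hS, hm⟩)
    exact ((h t' ht'l).trans_le (minLabel_le hmt)).not_ge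
      (S.min'_le _ (hE ((ht' _).1 t.minLabel_mem)))
  · intro hm t' ht'l
    have h1 := Finset.mem_sdiff.1 ((hl' _).1 ⟨t', ht'l, t'.minLabel_mem⟩)
    exact (minLabel_le ((ht' _).2 hm)).trans_lt
      (lt_of_le_of_ne (S.min'_le _ h1.1) fun h => h1.2 (h ▸ hm))

variable {K : Type*} [Field K] [CharZero K] {u v : K}

variable (u v) in
/-- The weight of a sequence of trees with increasing least labels, in which each tree can be a
left-to-right minimum of `x` kinds. -/
def sortedWeight (x : K) (l : List (ColoredTree k α)) : K :=
  (l.map (weight u v)).prod *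
    (rightLeftProd minLabel 1 0 l * ∏ i ∈ Finset.range l.length, (x + i))

theorem sortedWeight_cons {S E : Finset α} (hS : S.Nonempty) {t : ColoredTree k α}
    {l : List (ColoredTree k α)} (ht : t ∈ treesOn k E) (hl : l ∈ forestsOn k (S \ E))
    (hE : E ⊆ S) (x : K) : sortedWeight u v x (t :: l) =
      if S.min' hS ∈ E then x * (weight u v t * sortedWeight u v (x + 1) l) else 0 := by
  rw [sortedWeight, rightLeftProd, List.length_cons, Finset.prod_range_succ']
  simp only [forall_minLabel_lt_iff hS ht hl hE]
  split_ifs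
  · have : ∀ i ∈ Finset.range l.length, x + ((i + 1 : ℕ) : K) = x + 1 + i := fun i _ => by
      push_cast; ring
    rw [Finset.prod_congr rfl this, sortedWeight, List.map_cons, List.prod_cons]
    push_cast
    ring
  · simp

/-- The first tree must contain the least label of `S`. It takes the factor x of the rising
factorial and leaves x + 1 as parameter for the rest; `forestProd_add` sums the resulting
convolution. -/
theorem sum_sortedWeight (hk : (k : K) * u ≠ (k + 1) * v) (S : Finset α) (x : K) :
    ∑ l ∈ forestsOn k S, sortedWeight u v x l =
      forestPoly S.card (k * u) ((k + 1) * v) (x * v) := by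
  induction S using Finset.strongInduction generalizing x with
  | H S ih =>
  rcases S.eq_empty_or_nonempty with rfl | hS
  · simp [forestsOn_empty, sortedWeight, rightLeftProd, forestPoly_zero]
  set m := S.min' hS with hm
  have hmS : m ∈ S := S.min'_mem hS
  obtain ⟨n, hn⟩ : ∃ n, S.card = n + 1 := Nat.exists_eq_succ_of_ne_zero hS.card_pos.ne'
  have hn' : (S.erase m).card = n := by rw [Finset.card_erase_of_mem hmS, hn, Nat.add_sub_cancel]
  have hterm : ∀ E ∈ S.powerset,
      ∑ p ∈ treesOn k E ×ˢ forestsOn k (S \ E), sortedWeight u v x (p.1 :: p.2) =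
      if m ∈ E then x * (treeWeight k u v E.card *
        forestPoly (S.card - E.card) (k * u) ((k + 1) * v) ((x + 1) * v)) else 0 := by
    intro E hE
    rw [Finset.mem_powerset] at hE
    rw [Finset.sum_congr rfl fun p hp => sortedWeight_cons hS (Finset.mem_product.1 hp).1
      (Finset.mem_product.1 hp).2 hE x]
    split_ifs with hmE
    · rw [← sum_weight hk E, ← Finset.card_sdiff_of_subset hE,
        ← ih (S \ E) (Finset.sdiff_ssubset hE ⟨m, hmE⟩), Finset.sum_mul_sum, Finset.mul_sum,
        Finset.sum_product]
      simp only [Finset.mul_sum]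
    · simp
  rw [sum_forestsOn hS, Finset.sum_congr rfl hterm]
  -- The sets containing `m` are parametrized by subsets of the n other labels, which produces the
  -- binomial coefficients of n rather than of n + 1.
  have hins := Finset.sum_powerset_insert (Finset.notMem_erase m S) (fun E : Finset α =>
    if m ∈ E then x * (treeWeight k u v E.card *
        forestPoly (S.card - E.card) (k * u) ((k + 1) * v) ((x + 1) * v)) else 0)
  rw [Finset.insert_erase hmS] at hins
  rw [hins, Finset.sum_eq_zero fun E hE => if_neg fun h =>
    Finset.notMem_erase m S (Finset.mem_powerset.1 hE h), zero_add]
  have hterm' : ∀ E ∈ (S.erase m).powerset, (if m ∈ insert m E then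
      x * (treeWeight k u v (insert m E).card * forestPoly (S.card - (insert m E).card)
        (k * u) ((k + 1) * v) ((x + 1) * v)) else 0) =
      x * (v * (forestProd E.card (k * u) ((k + 1) * v) (k * v) *
        forestPoly (n - E.card) (k * u) ((k + 1) * v) ((x + 1) * v))) := by
    intro E hE
    have hmE : m ∉ E := fun h => Finset.notMem_erase m S (Finset.mem_powerset.1 hE h)
    rw [if_pos (Finset.mem_insert_self m E), Finset.card_insert_of_notMem hmE, hn,
      Nat.add_sub_add_right, treeWeight, if_neg (Nat.succ_ne_zero _), Nat.add_sub_cancel, mul_assoc v]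
  rw [Finset.sum_congr rfl hterm', ← Finset.mul_sum, ← Finset.mul_sum,
    Finset.sum_powerset_apply_card (fun i => forestProd i (k * u) ((k + 1) * v) (k * v) *
        forestPoly (n - i) (k * u) ((k + 1) * v) ((x + 1) * v)), hn', hn, forestPoly_succ]
  simp only [nsmul_eq_mul]
  rw [← forestProd_add hk, show x * v + ((k : K) + 1) * v = k * v + (x + 1) * v by ring]
  ring

theorem sum_pow_leftRightMinima (hk : (k : K) * u ≠ (k + 1) * v) (S : Finset α) (x : K) :
    ∑ l ∈ forestsOn k S, (l.map (weight u v)).prod * x ^ leftRightMinima (l.map root) =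
      forestPoly S.card (k * u) ((k + 1) * v) (x * v) := by
  rw [← sum_sortedWeight hk]
  simp only [sortedWeight]
  rw [← sum_mul_rightLeftProd_eq (forestsOn k S) (fun l => (l.map (weight u v)).prod) root
    minLabel x (fun l hl l' h => mem_forestsOn_of_perm hl h)
    (fun l l' h => (h.map _).prod_eq) (fun l hl => ?_)
    (fun l hl => injOn_of_nodup_flatMap_labels (nodup_of_mem_forestsOn hl) _ root_mem_labels)
    (fun l hl => injOn_of_nodup_flatMap_labels (nodup_of_mem_forestsOn hl) _ minLabel_mem)]
  -- Reversal turns left-to-right minima into the right-to-left minima of `rightLeftProd`.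
  · refine Finset.sum_nbij' List.reverse List.reverse ?_ ?_ ?_ ?_ ?_
    · exact fun l hl => mem_forestsOn_of_perm hl l.reverse_perm
    · exact fun l hl => mem_forestsOn_of_perm hl l.reverse_perm
    · simp
    · simp
    · intro l _
      rw [pow_leftRightMinima, (l.reverse_perm.map _).prod_eq]
  · exact nodup_of_nodup_flatMap_labels (nodup_of_mem_forestsOn hl)

end

end ColoredTree

-- Forests on [n], over a field of characteristic 0.

namespace ColoredForest
variable {k n : ℕ}

theorem coe_flatMap_labels (F : ColoredForest k n) :
    (F.trees.flatMap ColoredTree.labels : Multiset (Fin n)) = (Finset.univ : Finset (Fin n)).val :=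
  (Multiset.Nodup.ext (Multiset.coe_nodup.2 F.labels_nodup) Finset.univ.nodup).2 fun i => by
    simpa using F.mem_labels i

theorem length_flatMap_labels (F : ColoredForest k n) :
    (F.trees.flatMap ColoredTree.labels).length = n := by
  rw [← Multiset.coe_card, F.coe_flatMap_labels, Finset.card_val, Finset.card_fin]

theorem prop_le (F : ColoredForest k n) : F.prop ≤ n :=
  (ColoredTree.prod_map_weight (0 : ℤ) 0 F.trees).2.trans_eq F.length_flatMap_labels

theorem comp_le_prop (F : ColoredForest k n) : F.comp ≤ F.prop :=
  ((leftRightMinima_le_length _).trans_eq (List.length_map _)).trans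
    (ColoredTree.length_le_sum_map_prop F.trees)

theorem sum_eq_sum_forestsOn {M : Type*} [AddCommMonoid M]
    (f : List (ColoredTree k (Fin n)) → M) :
    ∑ F : ColoredForest k n, f F.trees = ∑ l ∈ ColoredTree.forestsOn k Finset.univ, f l := by
  refine Finset.sum_bij (fun F _ => F.trees) ?_ ?_ ?_ ?_
  · exact fun F _ => ColoredTree.mem_forestsOn.2 ⟨F.colorsOrdered, F.coe_flatMap_labels⟩
  · exact fun F _ G _ h => ColoredForest.ext h
  · intro l hl
    obtain ⟨h1, h2⟩ := ColoredTree.mem_forestsOn.1 hl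
    refine ⟨⟨l, h1, ColoredTree.nodup_of_mem_forestsOn hl, fun i => ?_⟩, Finset.mem_univ _, rfl⟩
    rw [← Multiset.mem_coe, h2]
    exact Finset.mem_univ i
  · exact fun F _ => rfl

theorem sum_eq_forestPoly_of_field {K : Type*} [Field K] [CharZero K] {u v : K} (hv : v ≠ 0)
    (hk : (k : K) * u ≠ (k + 1) * v) (w : K) :
    ∑ F : ColoredForest k n, u ^ (n - F.prop) * v ^ (F.prop - F.comp) * w ^ F.comp =
      forestPoly n (k * u) ((k + 1) * v) w := by
  have h := ColoredTree.sum_pow_leftRightMinima hk (Finset.univ : Finset (Fin n)) (w / v)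
  rw [div_mul_cancel₀ w hv, Finset.card_fin, ← sum_eq_sum_forestsOn] at h
  rw [← h]
  refine Finset.sum_congr rfl fun F _ => ?_
  rw [(ColoredTree.prod_map_weight u v F.trees).1, F.length_flatMap_labels]
  change _ = u ^ (n - F.prop) * v ^ F.prop * (w / v) ^ F.comp
  have hvp : v ^ F.prop = v ^ (F.prop - F.comp) * v ^ F.comp := by
    rw [← pow_add, Nat.sub_add_cancel F.comp_le_prop]
  rw [hvp, div_pow]
  field_simp

end ColoredForest

-- Passage to polynomials over ℤ and to arbitrary commutative rings.

theorem map_forestPoly {R S : Type*} [CommRing R] [CommRing S] (f : R →+* S) (n : ℕ) (a b c : R) :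
    f (forestPoly n a b c) = forestPoly n (f a) (f b) (f c) := by
  cases n <;> simp [forestPoly]

theorem ColoredForest.sum_eq_forestPoly_of_isDomain {k n : ℕ} {R : Type*} [CommRing R] [IsDomain R]
    [CharZero R] {u v : R} (hv : v ≠ 0) (hk : (k : R) * u ≠ (k + 1) * v) (w : R) :
    ∑ F : ColoredForest k n, u ^ (n - F.prop) * v ^ (F.prop - F.comp) * w ^ F.comp =
      forestPoly n (k * u) ((k + 1) * v) w := by
  have hφ : Function.Injective (algebraMap R (FractionRing R)) := IsFractionRing.injective _ _
  have := charZero_of_injective_algebraMap hφ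
  apply hφ
  rw [map_forestPoly]
  simp only [map_sum, map_mul, map_pow, map_add, map_natCast, map_one]
  refine sum_eq_forestPoly_of_field ((map_ne_zero_iff _ hφ).2 hv) (fun h => hk (hφ ?_)) _
  simpa only [map_mul, map_add, map_natCast, map_one] using h

open MvPolynomial in
theorem ColoredForest.sum_eq_forestPoly_X (k n : ℕ) :
    ∑ F : ColoredForest k n, (X 0 : MvPolynomial (Fin 3) ℤ) ^ (n - F.prop) *
      (X 1 : MvPolynomial (Fin 3) ℤ) ^ (F.prop - F.comp) *
      (X 2 : MvPolynomial (Fin 3) ℤ) ^ F.comp =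
      forestPoly n ((k : MvPolynomial (Fin 3) ℤ) * X 0)
        (((k : MvPolynomial (Fin 3) ℤ) + 1) * X 1) (X 2) := by
  refine sum_eq_forestPoly_of_isDomain (X_ne_zero 1) (fun h => ?_) _
  -- At u = 0, v = 1 the equality ku = (k+1)v would read 0 = k + 1 in ℤ.
  have h2 := congrArg (eval ![0, 1, 0]) h
  simp only [map_mul, map_add, map_natCast, map_one, eval_X, Matrix.cons_val_zero,
    Matrix.cons_val_one, mul_zero, mul_one] at h2
  omega

theorem mainTheorem7 (k n : ℕ) :
    (∀ F : ColoredForest k n, F.comp ≤ F.prop ∧ F.prop ≤ n) ∧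
    ∀ {R : Type*} [CommRing R] (u v w : R),
      ∑ F : ColoredForest k n, u ^ (n - F.prop) * v ^ (F.prop - F.comp) * w ^ F.comp
        = forestPoly n ((k : R) * u) (((k : R) + 1) * v) w := by
  refine ⟨fun F => ⟨F.comp_le_prop, F.prop_le⟩, fun {R} _ u v w => ?_⟩
  have h := congrArg (MvPolynomial.eval₂Hom (Int.castRingHom R) ![u, v, w])
    (ColoredForest.sum_eq_forestPoly_X k n)
  simpa [map_forestPoly] using h
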